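/- For probability measures $P$ and $Q$ on the same measurable space, let $$\chi^2(P,Q)=\int\Big(\frac{dP}{dQ}-1\Big)^2\,dQ\in[0,\infty]\quad\text{if }P\ll Q,\qquad \chi^2(P,Q)=\infty\quad\text{otherwise.}$$ Equivalently, $\chi^2(P,Q)=\int\frac{(p-q)^2}{q}\,d\mu$, where $p,q$ are the densities of $P,Q$ with respect to any dominating $\sigma$-finite measure $\mu$ (with $0/0=0$ and $a/0=\infty$ for $a>0$). For random elements $X$ and $Z$ of the same measurable space, $\chi^2(X,Z)$ denotes the $\chi^2$-divergence of the distribution of $X$ from the distribution of $Z$. **Proposition 10.1.** Let $H$ be a Euclidean space (a finite-dimensional real inner product space), and let $H=H'\oplus H''$ be an orthogonal decomposition into two linear subspaces (possibly of dimension $0$). Let $X$ be any random vector in $H$, and let $X'=\mathrm{Proj}_{H'}(X)$ and $X''=\mathrm{Proj}_{H''}(X)$ be its orthogonal projections, regarded as random vectors in $H'$ and $H''$. Let $Z,Z',Z''$ be standard normal random vectors in $H,H',H''$, respectively (mean zero and identity covariance operator). Then, in $[0,\infty]$, $$\chi^2(X,Z)\;\ge\;\chi^2(X',Z')+\chi^2(X'',Z'').$$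 -/

import Mathlib

open MeasureTheory ProbabilityTheory
open scoped ENNReal

/-- The `χ²`-divergence (Pearson) of a probability measure `P` from a probability measure `Q`:
`∫ (dP/dQ - 1)² dQ` if `P ≪ Q`, and `∞` otherwise. The value of the integral, possibly `∞`, is
taken in `[0, ∞]`. -/
noncomputable def chiSqDiv {α : Type*} [MeasurableSpace α] (P Q : Measure α) : ℝ≥0∞ :=
  open Classical in
  if P ≪ Q then ∫⁻ x, ENNReal.ofReal (((P.rnDeriv Q x).toReal - 1) ^ 2) ∂Q else ∞

/-- The `χ²`-divergence is `∫ (p - q)² / q dμ` for every dominating `σ`-finite measure `μ`, where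
`p = dP/dμ`, `q = dQ/dμ`, with the conventions `0 / 0 = 0` and `a / 0 = ∞` for `a > 0`. -/
theorem chiSqDiv_eq_lintegral {α : Type*} [MeasurableSpace α] (P Q μ : Measure α)
    [IsProbabilityMeasure P] [IsProbabilityMeasure Q] [SigmaFinite μ] (hP : P ≪ μ) (hQ : Q ≪ μ) :
    chiSqDiv P Q = ∫⁻ x, ENNReal.ofReal (((P.rnDeriv μ x).toReal - (Q.rnDeriv μ x).toReal) ^ 2)
      / Q.rnDeriv μ x ∂μ := by
  by_cases h : P ≪ Q
  · rw [chiSqDiv, if_pos h, ← lintegral_rnDeriv_mul hQ (by fun_prop)]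
    apply lintegral_congr_ae
    filter_upwards [Measure.rnDeriv_mul_rnDeriv (κ := μ) h, P.rnDeriv_lt_top μ,
      Q.rnDeriv_lt_top μ] with x hx hp hq
    simp only [Pi.mul_apply] at hx
    rw [← hx] at hp ⊢
    generalize P.rnDeriv Q x = r at *
    generalize Q.rnDeriv μ x = q at *
    rcases eq_or_ne q 0 with rfl | hq0
    · simp
    rw [ENNReal.eq_div_iff hq0 hq.ne, ENNReal.toReal_mul]
    conv_lhs => rw [← ENNReal.ofReal_toReal hq.ne]
    rw [← ENNReal.ofReal_mul ENNReal.toReal_nonneg, ← ENNReal.ofReal_mul ENNReal.toReal_nonneg]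
    congr 1
    ring
  · rw [chiSqDiv, if_neg h]
    symm
    by_contra hfin
    apply h
    have hae := ae_lt_top (by fun_prop) hfin
    rw [← Measure.withDensity_rnDeriv_eq P μ hP, ← Measure.withDensity_rnDeriv_eq Q μ hQ]
    refine Measure.AbsolutelyContinuous.mk fun s hs h0 ↦ ?_
    rw [withDensity_apply _ hs, lintegral_eq_zero_iff (by fun_prop)] at h0 ⊢
    filter_upwards [h0, ae_restrict_of_ae hae, ae_restrict_of_ae (P.rnDeriv_lt_top μ)]
      with x hx hx' hp
    simp only [Pi.zero_apply] at hx ⊢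
    by_contra hne
    have : 0 < (P.rnDeriv μ x).toReal := ENNReal.toReal_pos hne hp.ne
    rw [hx, ENNReal.div_zero] at hx'
    · exact lt_irrefl _ hx'
    · simp only [ENNReal.toReal_zero, sub_zero, ne_eq, ENNReal.ofReal_eq_zero, not_le]
      positivity

/-- The `χ²`-distance `χ²(X, Z)` between random elements `X` and `Z` of a measurable space, each
defined on its own probability space: the `χ²`-divergence of the law of `X` from the law of `Z`. -/
noncomputable def chiSqDist {Ω Ω' α : Type*} [MeasurableSpace Ω] [MeasurableSpace Ω']
    [MeasurableSpace α] (X : Ω → α) (P : Measure Ω) (Z : Ω' → α) (Q : Measure Ω') : ℝ≥0∞ :=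
  chiSqDiv (P.map X) (Q.map Z)

/-! Let `Q` be the Gaussian law and `f = dP/dQ - 1`, with `f` in `L²(Q)` (otherwise the right side
is infinite). Taking the image under a map `S` replaces `f` by `E[f | S]`
(`chiSqDiv_map_eq_condExp`), so each divergence is a squared `L²(Q)` norm. The two projections are
independent under `Q` and `f` is centred, so the two conditional expectations are orthogonal
projections of `f` onto orthogonal subspaces, and Bessel's inequality (`integral_sq_condExp_add_le`)
concludes. -/

theorem integral_condExp_mul_self {α : Type*} {m m0 : MeasurableSpace α} (hm : m ≤ m0)
    (μ : Measure[m0] α) [IsFiniteMeasure μ] {f : α → ℝ} (hf : MemLp f 2 μ) :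
    ∫ x, f x * (μ[f|m]) x ∂μ = ∫ x, (μ[f|m]) x ^ 2 ∂μ := by
  have hc : MemLp (μ[f|m]) 2 μ := hf.condExp one_le_two
  have h := condExp_mul_of_stronglyMeasurable_right (stronglyMeasurable_condExp (m := m) (f := f))
    (hf.integrable_mul hc) (hf.integrable one_le_two)
  -- Tower property; the pull-out rule `h` then makes the integrand a square.
  rw [← integral_condExp hm (f := fun x ↦ f x * (μ[f|m]) x)]
  refine (integral_congr_ae h).trans ?_
  simp [sq]

/-- Bessel's inequality for the conditional expectations of a centred function given two
independent maps. -/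
theorem integral_sq_condExp_add_le {α β γ : Type*} [MeasurableSpace α] [mβ : MeasurableSpace β]
    [mγ : MeasurableSpace γ] (Q : Measure α) [IsProbabilityMeasure Q] {S : α → β} {T : α → γ}
    (hS : Measurable S) (hT : Measurable T) (hST : IndepFun S T Q) {f : α → ℝ} (hf : MemLp f 2 Q)
    (hf0 : ∫ x, f x ∂Q = 0) :
    ∫ x, (Q[f|mβ.comap S]) x ^ 2 ∂Q + ∫ x, (Q[f|mγ.comap T]) x ^ 2 ∂Q ≤ ∫ x, f x ^ 2 ∂Q := by
  have hg := integral_condExp_mul_self hS.comap_le Q hf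
  have hh := integral_condExp_mul_self hT.comap_le Q hf
  have hgL : MemLp (Q[f|mβ.comap S]) 2 Q := hf.condExp one_le_two
  have hhL : MemLp (Q[f|mγ.comap T]) 2 Q := hf.condExp one_le_two
  have hgh : ∫ x, (Q[f|mβ.comap S]) x * (Q[f|mγ.comap T]) x ∂Q = 0 := by
    have hind : IndepFun (Q[f|mβ.comap S]) (Q[f|mγ.comap T]) Q := by
      rw [IndepFun_iff_Indep] at hST ⊢
      exact indep_of_indep_of_le_left (indep_of_indep_of_le_right hST
        stronglyMeasurable_condExp.measurable.comap_le)
        stronglyMeasurable_condExp.measurable.comap_le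
    have := hind.integral_mul_eq_mul_integral hgL.aestronglyMeasurable hhL.aestronglyMeasurable
    rw [integral_condExp hS.comap_le, hf0, zero_mul] at this
    exact this
  generalize Q[f|mβ.comap S] = g at *
  generalize Q[f|mγ.comap T] = h at *
  -- By `hg`, `hh` and `hgh`, this integral equals `∫ f² - ∫ g² - ∫ h²`.
  have hpos : 0 ≤ ∫ x, (f x - g x - h x) ^ 2 ∂Q := integral_nonneg fun x ↦ sq_nonneg _
  have i1 := hf.integrable_sq
  have i2 := hgL.integrable_sq
  have i3 := hhL.integrable_sq
  have i4 : Integrable (fun x ↦ f x * g x) Q := hf.integrable_mul hgL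
  have i5 : Integrable (fun x ↦ f x * h x) Q := hf.integrable_mul hhL
  have i6 : Integrable (fun x ↦ g x * h x) Q := hgL.integrable_mul hhL
  have hexp : ∀ x, (f x - g x - h x) ^ 2
      = f x ^ 2 + g x ^ 2 + h x ^ 2 - 2 * (f x * g x) - 2 * (f x * h x) + 2 * (g x * h x) :=
    fun x ↦ by ring
  simp_rw [hexp] at hpos
  rw [integral_add (by fun_prop) (by fun_prop), integral_sub (by fun_prop) (by fun_prop),
    integral_sub (by fun_prop) (by fun_prop), integral_add (by fun_prop) (by fun_prop),
    integral_add (by fun_prop) (by fun_prop)] at hpos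
  simp only [integral_const_mul] at hpos
  linarith

/-- The density of the image law, composed with `S`, is the conditional expectation of `dP/dQ` given
`S`; the rest is change of variables. -/
theorem chiSqDiv_map_eq_condExp {α β : Type*} [MeasurableSpace α] [mβ : MeasurableSpace β]
    {P Q : Measure α} [IsProbabilityMeasure P] [IsProbabilityMeasure Q] (hPQ : P ≪ Q) {S : α → β}
    (hS : Measurable S) (hf : MemLp (fun x ↦ (P.rnDeriv Q x).toReal - 1) 2 Q) :
    chiSqDiv (P.map S) (Q.map S) = ENNReal.ofReal
      (∫ x, (Q[fun x ↦ (P.rnDeriv Q x).toReal - 1|mβ.comap S]) x ^ 2 ∂Q) := by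
  have := Measure.isProbabilityMeasure_map (μ := Q) hS.aemeasurable
  rw [chiSqDiv, if_pos (hPQ.map hS), lintegral_map (by fun_prop) hS,
    ofReal_integral_eq_lintegral_ofReal (hf.condExp one_le_two).integrable_sq
      (ae_of_all _ fun x ↦ sq_nonneg _)]
  refine lintegral_congr_ae ?_
  filter_upwards [toReal_rnDeriv_map hPQ hS, condExp_sub (μ := Q)
    (f := fun x ↦ (P.rnDeriv Q x).toReal) (g := fun _ ↦ (1 : ℝ))
    Measure.integrable_toReal_rnDeriv (integrable_const 1) (mβ.comap S)] with x hx hx'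
  rw [hx]
  change (Q[fun x ↦ (P.rnDeriv Q x).toReal - 1|mβ.comap S]) x = _ at hx'
  rw [hx', Pi.sub_apply, condExp_const hS.comap_le]

/-- The `χ²`-divergence dominates the sum of the `χ²`-divergences of the images under two maps that
are independent under the reference measure. -/
theorem chiSqDiv_map_add_chiSqDiv_map_le {α β γ : Type*} [MeasurableSpace α] [MeasurableSpace β]
    [MeasurableSpace γ] (P Q : Measure α) [IsProbabilityMeasure P] [IsProbabilityMeasure Q]
    {S : α → β} {T : α → γ} (hS : Measurable S) (hT : Measurable T) (hST : IndepFun S T Q) :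
    chiSqDiv (P.map S) (Q.map S) + chiSqDiv (P.map T) (Q.map T) ≤ chiSqDiv P Q := by
  by_cases hPQ : P ≪ Q
  swap
  · simp [chiSqDiv, hPQ]
  by_cases hfin : chiSqDiv P Q = ∞
  · simp [hfin]
  have hm : Measurable fun x ↦ (P.rnDeriv Q x).toReal - 1 := by fun_prop
  have hchi : chiSqDiv P Q = ∫⁻ x, ENNReal.ofReal (((P.rnDeriv Q x).toReal - 1) ^ 2) ∂Q := by
    rw [chiSqDiv, if_pos hPQ]
  have hf : MemLp (fun x ↦ (P.rnDeriv Q x).toReal - 1) 2 Q := by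
    rw [memLp_two_iff_integrable_sq hm.aestronglyMeasurable]
    refine ⟨(hm.pow_const 2).aestronglyMeasurable, ?_⟩
    rw [hasFiniteIntegral_iff_ofReal (ae_of_all _ fun x ↦ sq_nonneg _), ← hchi]
    exact Ne.lt_top hfin
  have hf0 : ∫ x, ((P.rnDeriv Q x).toReal - 1) ∂Q = 0 := by
    rw [integral_sub Measure.integrable_toReal_rnDeriv (integrable_const 1),
      Measure.integral_toReal_rnDeriv hPQ]
    simp
  rw [chiSqDiv_map_eq_condExp hPQ hS hf, chiSqDiv_map_eq_condExp hPQ hT hf, hchi,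
    ← ENNReal.ofReal_add (integral_nonneg fun x ↦ sq_nonneg _)
      (integral_nonneg fun x ↦ sq_nonneg _),
    ← ofReal_integral_eq_lintegral_ofReal hf.integrable_sq (ae_of_all _ fun x ↦ sq_nonneg _)]
  exact ENNReal.ofReal_le_ofReal (integral_sq_condExp_add_le Q hS hT hST hf hf0)

theorem charFun_map_orthogonalProjectionOnto {H : Type*} [NormedAddCommGroup H] [InnerProductSpace ℝ H]
    [FiniteDimensional ℝ H] [MeasurableSpace H] [BorelSpace H]
    (μ : Measure H) (K : Submodule ℝ H) (t : K) :
    charFun (μ.map K.orthogonalProjectionOnto) t = charFun μ (t : H) := by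
  rw [charFun_apply, charFun_apply, integral_map (by fun_prop) (by fun_prop)]
  simp

theorem stdGaussian_map_orthogonalProjectionOnto {H : Type*} [NormedAddCommGroup H] [InnerProductSpace ℝ H]
    [FiniteDimensional ℝ H] [MeasurableSpace H] [BorelSpace H]
    (K : Submodule ℝ H) :
    (stdGaussian H).map K.orthogonalProjectionOnto = stdGaussian K := by
  have := Measure.isProbabilityMeasure_map (μ := stdGaussian H)
    (f := K.orthogonalProjectionOnto) (by fun_prop)
  apply Measure.ext_of_charFun
  ext t
  rw [charFun_map_orthogonalProjectionOnto, charFun_stdGaussian, charFun_stdGaussian]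
  simp

/-- The joint characteristic function at `(t₁, t₂)` is the Gaussian one at `t₁ + t₂`, which factors
because `‖t₁ + t₂‖² = ‖t₁‖² + ‖t₂‖²`. -/
theorem indepFun_orthogonalProjectionOnto_stdGaussian {H : Type*} [NormedAddCommGroup H] [InnerProductSpace ℝ H]
    [FiniteDimensional ℝ H] [MeasurableSpace H] [BorelSpace H]
    {K L : Submodule ℝ H} (hKL : K ⟂ L) :
    IndepFun K.orthogonalProjectionOnto L.orthogonalProjectionOnto (stdGaussian H) := by
  rw [indepFun_iff_charFun_prod (by fun_prop) (by fun_prop)]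
  intro t
  have hnorm : ‖(t.ofLp.1 : H) + (t.ofLp.2 : H)‖ ^ 2 = ‖t.ofLp.1‖ ^ 2 + ‖t.ofLp.2‖ ^ 2 := by
    rw [norm_add_sq_real, hKL.inner_eq t.ofLp.1.2 t.ofLp.2.2]
    simp
  have hmap : charFun ((stdGaussian H).map fun x ↦ WithLp.toLp 2
      (K.orthogonalProjectionOnto x, L.orthogonalProjectionOnto x)) t
      = charFun (stdGaussian H) ((t.ofLp.1 : H) + (t.ofLp.2 : H)) := by
    rw [charFun_apply, charFun_apply, integral_map (by fun_prop) (by fun_prop)]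
    simp [WithLp.prod_inner_apply, inner_add_right]
  rw [hmap, stdGaussian_map_orthogonalProjectionOnto, stdGaussian_map_orthogonalProjectionOnto]
  simp only [charFun_stdGaussian, ← Complex.exp_add]
  congr 1
  rw [← Complex.ofReal_pow, hnorm]
  push_cast
  ring

theorem proposition10p1 {H : Type*} [NormedAddCommGroup H] [InnerProductSpace ℝ H]
    [FiniteDimensional ℝ H] [MeasurableSpace H] [BorelSpace H]
    (H₁ H₂ : Submodule ℝ H) (hperp : H₁ ⟂ H₂) (hsum : H₁ ⊔ H₂ = ⊤)
    {Ω : Type*} [MeasurableSpace Ω] (P : Measure Ω) [IsProbabilityMeasure P]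
    (X : Ω → H) (hX : AEMeasurable X P)
    {Ω₀ : Type*} [MeasurableSpace Ω₀] (Q₀ : Measure Ω₀)
    (Z : Ω₀ → H) (hZ : HasLaw Z (stdGaussian H) Q₀)
    {Ω₁ : Type*} [MeasurableSpace Ω₁] (Q₁ : Measure Ω₁)
    (Z₁ : Ω₁ → H₁) (hZ₁ : HasLaw Z₁ (stdGaussian H₁) Q₁)
    {Ω₂ : Type*} [MeasurableSpace Ω₂] (Q₂ : Measure Ω₂)
    (Z₂ : Ω₂ → H₂) (hZ₂ : HasLaw Z₂ (stdGaussian H₂) Q₂) :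
    chiSqDist (fun ω ↦ H₁.orthogonalProjectionOnto (X ω)) P Z₁ Q₁
        + chiSqDist (fun ω ↦ H₂.orthogonalProjectionOnto (X ω)) P Z₂ Q₂
      ≤ chiSqDist X P Z Q₀ := by
  have := Measure.isProbabilityMeasure_map hX
  simp only [chiSqDist]
  -- Only laws matter, so both smaller Gaussians may be taken as images of the one on `H`.
  rw [hZ.map_eq, hZ₁.map_eq, hZ₂.map_eq, ← stdGaussian_map_orthogonalProjectionOnto H₁,
    ← stdGaussian_map_orthogonalProjectionOnto H₂]
  have hmap (K : Submodule ℝ H) : P.map (fun ω ↦ K.orthogonalProjectionOnto (X ω))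
      = (P.map X).map K.orthogonalProjectionOnto :=
    (AEMeasurable.map_map_of_aemeasurable (by fun_prop) hX).symm
  rw [hmap, hmap]
  exact chiSqDiv_map_add_chiSqDiv_map_le _ _ (by fun_prop) (by fun_prop)
    (indepFun_orthogonalProjectionOnto_stdGaussian hperp)
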